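/- Let $A$ be a self-adjoint operator, bounded or semi-bounded from below, in a complex Hilbert space $\mathcal H$ with inner product $\langle\cdot,\cdot\rangle$. Let $\mathfrak a$ be its closed quadratic form, $m=\min\sigma(A)$, and $\|u\|_{\mathfrak a}=(\mathfrak a[u,u]-(m-1)\langle u,u\rangle)^{1/2}$ for $u\in\mathrm{Dom}(\mathfrak a)$. Let $a<b$ be real numbers with $a,b\in\rho(A)$, let $\Delta=[a,b]$, and suppose that $\sigma_{\mathrm{ess}}(A)\cap\Delta=\varnothing$. Let $\mathcal L(\Delta)$ be the spectral subspace of $A$ for $\Delta$, that is, the span of the eigenvectors of $A$ with eigenvalue in $\Delta$, and let $E$ be the orthogonal projection onto $\mathcal L(\Delta)$. Let $(\mathcal L_n)$ be a sequence of finite-dimensional subspaces of $\mathrm{Dom}(\mathfrak a)$ such that for every $u\in\mathrm{Dom}(\mathfrak a)$ there are $u_n\in\mathcal L_n$ with $\|u-u_n\|_{\mathfrak a}\to0$. For a finite-dimensional subspace $\mathcal K\subset\mathrm{Dom}(\mathfrak a)$, let $\sigma(A,\mathcal K)$ be the set of those $\mu\in\mathbb R$ for which there is a non-zero $u\in\mathcal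 K$ with $\mathfrak a[u,v]=\mu\langle u,v\rangle$ for all $v\in\mathcal K$. Let $\mathcal L_n(\Delta)$ be the span of the vectors $u\in\mathcal L_n$ such that, for some $\mu\in\Delta$, $\mathfrak a[u,v]=\mu\langle u,v\rangle$ for all $v\in\mathcal L_n$, and let $Q_n$ be the orthogonal projection of $\mathcal H$ onto $\mathcal L_n(\Delta)$. For subspaces $\mathcal K,\mathcal M$ of $\mathcal H$ let $\delta(\mathcal K,\mathcal M)=\sup\{\mathrm{dist}(u,\mathcal M):u\in\mathcal K,\ \|u\|=1\}$, with $\delta(\{0\},\mathcal M)=0$. Let $\mathcal L$ be a finite-dimensional subspace of $\mathcal H$ and $P$ the orthogonal projection onto $\mathcal L$. Let $\gamma$ be the smallest non-zero element of the discrete spectrum of $EPE$ (with $\gamma=0$ if there is none), and let $\mathcal M_n$ be the spectral subspace of the self-adjoint operator $Q_nP|_{\mathcal L_n(\Delta)}$ on $\mathcal L_n(\Delta)$ for the interval $[\gamma/2,1]$, that is, the span of its eigenvectors with eigenvalue in this interval. If $\delta(\mathcal L(\Delta),\mathcal L)<1$ and $\delta(\mathcal L_n(\Delta),\mathcal L(\Delta))\to0$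 (that is, spectral pollution does not occur in $\Delta$ for $(\mathcal L_n)$), then \[ \sigma(A,\mathcal M_n)=\sigma(A,\mathcal L_n)\cap\Delta\qquad\text{for all sufficiently large } n. \] -/

import Mathlib

open Filter Topology

namespace Galerkin

noncomputable section

variable {H : Type*} [NormedAddCommGroup H] [InnerProductSpace ℂ H]

/-! ### Spectra of (possibly unbounded) operators -/

/-- The resolvent set of an operator `A` in `H`: those `z` for which `A - z` maps the domain of `A`
bijectively onto `H` with bounded everywhere defined inverse. -/
def resolventSet (A : H →ₗ.[ℂ] H) : Set ℂ :=
  {z | ∃ R : H →L[ℂ] H,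
    (∀ y : H, ∃ h : R y ∈ A.domain, A ⟨R y, h⟩ - z • R y = y) ∧
    ∀ x : A.domain, R (A x - z • (x : H)) = x}

/-- The spectrum of `A`. -/
def spectrum (A : H →ₗ.[ℂ] H) : Set ℂ := (resolventSet A)ᶜ

/-- The eigenspace `ker (A - z)`, as a subspace of `H`. -/
def eigenspace (A : H →ₗ.[ℂ] H) (z : ℂ) : Submodule ℂ H where
  carrier := {u | ∃ h : u ∈ A.domain, A ⟨u, h⟩ = z • u}
  zero_mem' := ⟨A.domain.zero_mem, by
    rw [smul_zero]; exact A.map_zero⟩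
  add_mem' := by
    rintro u v ⟨hu, hu'⟩ ⟨hv, hv'⟩
    refine ⟨A.domain.add_mem hu hv, ?_⟩
    rw [smul_add, ← hu', ← hv']
    exact A.map_add ⟨u, hu⟩ ⟨v, hv⟩
  smul_mem' := by
    rintro c u ⟨hu, hu'⟩
    refine ⟨A.domain.smul_mem c hu, ?_⟩
    rw [smul_comm, ← hu']
    exact A.map_smul c ⟨u, hu⟩

/-- The discrete spectrum: eigenvalues of finite multiplicity that are isolated points of the
spectrum. -/
def discreteSpectrum (A : H →ₗ.[ℂ] H) : Set ℂ :=
  {z | z ∈ spectrum A ∧ (∃ ε > 0, ∀ w ∈ spectrum A, dist w z < ε → w = z) ∧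
    eigenspace A z ≠ ⊥ ∧ FiniteDimensional ℂ (eigenspace A z)}

/-- The essential spectrum (of a self-adjoint operator): the complement of the discrete spectrum in
the spectrum. -/
def essentialSpectrum (A : H →ₗ.[ℂ] H) : Set ℂ := spectrum A \ discreteSpectrum A

/-- `A` is bounded from below: `⟨Au, u⟩ ≥ c ‖u‖²` for some real `c`. Bounded symmetric operators
have this property. -/
def IsSemibounded (A : H →ₗ.[ℂ] H) : Prop :=
  ∃ c : ℝ, ∀ x : A.domain, c * ‖(x : H)‖ ^ 2 ≤ (inner ℂ (x : H) (A x)).re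

/-- `m = min σ(A)`. -/
def specMin (A : H →ₗ.[ℂ] H) : ℝ := sInf {t : ℝ | (t : ℂ) ∈ spectrum A}

/-! ### The quadratic form of a semi-bounded self-adjoint operator

It is the closure of the form `⟨Au, v⟩`, `u, v ∈ Dom A`. The inner product of Mathlib is conjugate
linear in its first argument, so that `⟨u, v⟩` (linear in `u`) is `inner ℂ v u`. -/

/-- The sequence `x` in `Dom A` is form-convergent to `u`: it converges to `u` in `H` and
`⟨A (x j - x k), x j - x k⟩ → 0` as `j, k → ∞`. -/
def FormApprox (A : H →ₗ.[ℂ] H) (x : ℕ → A.domain) (u : H) : Prop :=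
  Tendsto (fun k => (x k : H)) atTop (𝓝 u) ∧
  Tendsto (fun p : ℕ × ℕ => inner ℂ ((x p.1 - x p.2 : A.domain) : H) (A (x p.1 - x p.2)))
    atTop (𝓝 0)

/-- The form domain `Dom 𝔞`. -/
def formDomain (A : H →ₗ.[ℂ] H) : Set H := {u | ∃ x : ℕ → A.domain, FormApprox A x u}

open Classical in
/-- The form `𝔞[u, v] = lim ⟨A (x k), y k⟩`, where `x`, `y` are form-convergent to `u`, `v`. The
limit exists and does not depend on the choice of `x` and `y`, see `tendsto_form`. -/
def form (A : H →ₗ.[ℂ] H) (u v : H) : ℂ :=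
  if h : u ∈ formDomain A ∧ v ∈ formDomain A then
    limUnder atTop fun k => inner ℂ (h.2.choose k : H) (A (h.1.choose k))
  else 0

/-- The norm `‖u‖_𝔞 = (𝔞[u, u] - (m - 1) ⟨u, u⟩) ^ (1/2)`. -/
def formNorm (A : H →ₗ.[ℂ] H) (u : H) : ℝ :=
  Real.sqrt ((form A u u).re - (specMin A - 1) * ‖u‖ ^ 2)

/-! ### Subspaces -/

/-- `δ(L, M) = sup {dist(u, M) : u ∈ L, ‖u‖ = 1}`, with `δ({0}, M) = 0`. -/
def gap (L M : Submodule ℂ H) : ℝ :=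
  sSup {r | ∃ u ∈ L, ‖u‖ = 1 ∧ r = Metric.infDist u (M : Set H)}

/-- The orthogonal projection of `H` onto (the closure of) the subspace `K`. It is only used for
subspaces that are in fact finite-dimensional. -/
def proj [CompleteSpace H] (K : Submodule ℂ H) : H →L[ℂ] H :=
  K.topologicalClosure.starProjection

/-- `𝓛(Δ)` for `Δ = [a, b]`: the span of the eigenvectors of `A` with eigenvalue in `Δ`. -/
def eigenspaceIn (A : H →ₗ.[ℂ] H) (a b : ℝ) : Submodule ℂ H :=
  ⨆ t ∈ Set.Icc a b, eigenspace A (t : ℂ)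

/-- The Galerkin eigenvalues `σ(A, L)`. -/
def galerkinSpectrum (A : H →ₗ.[ℂ] H) (L : Submodule ℂ H) : Set ℝ :=
  {μ | ∃ u ∈ L, u ≠ 0 ∧ ∀ v ∈ L, form A u v = (μ : ℂ) * inner ℂ v u}

/-- `L(Δ)` for a trial space `L` and `Δ = [a, b]`: the span of the Galerkin eigenvectors with
Galerkin eigenvalue in `Δ`. -/
def galerkinSpaceIn (A : H →ₗ.[ℂ] H) (L : Submodule ℂ H) (a b : ℝ) : Submodule ℂ H :=
  Submodule.span ℂ
    {u | u ∈ L ∧ ∃ μ ∈ Set.Icc a b, ∀ v ∈ L, form A u v = (μ : ℂ) * inner ℂ v u}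

/-- `γ = min σ_dis(EPE)`, where `E`, `P` are the orthogonal projections onto `𝓛(Δ)`, `L`. On an
infinite-dimensional space `0` is not in the discrete spectrum of the finite rank operator `EPE`;
on a finite-dimensional one it is left out here. -/
def gamma [CompleteSpace H] (A : H →ₗ.[ℂ] H) (a b : ℝ) (L : Submodule ℂ H) : ℝ :=
  let E := proj (eigenspaceIn A a b)
  let P := proj L
  sInf {t : ℝ | t ≠ 0 ∧ (t : ℂ) ∈ discreteSpectrum (((E ∘L P ∘L E : H →L[ℂ] H) : H →ₗ[ℂ] H).toPMap ⊤)}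

/-- The spectral subspace of `Q P` restricted to `K` for the interval `[s, 1]`, where `Q`, `P` are
the orthogonal projections onto the finite-dimensional spaces `K`, `L`: the span of the eigenvectors
with eigenvalue in `[s, 1]`. -/
def compressionSpace [CompleteSpace H] (K L : Submodule ℂ H) (s : ℝ) : Submodule ℂ H :=
  Submodule.span ℂ {u | u ∈ K ∧ ∃ μ ∈ Set.Icc s 1, proj K (proj L u) = (μ : ℂ) • u}

/-- The space `𝓜_n` obtained from the trial space `Ln = 𝓛_n` and the auxiliary space `L`: the
spectral subspace of `Q_n P` restricted to `𝓛_n(Δ)` for the interval `[γ/2, 1]`. -/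
def filteredSpace [CompleteSpace H] (A : H →ₗ.[ℂ] H) (a b : ℝ) (L Ln : Submodule ℂ H) :
    Submodule ℂ H :=
  compressionSpace (galerkinSpaceIn A Ln a b) L (gamma A a b L / 2)

/-! ### The form is well defined -/

theorem core_limit {V : Type*} [AddCommGroup V] [Module ℂ V] (c : InnerProductSpace.Core ℂ V)
    (x y x' y' : ℕ → V)
    (hx : Tendsto (fun p : ℕ × ℕ => c.inner (x p.1 - x p.2) (x p.1 - x p.2)) atTop (𝓝 0))
    (hy : Tendsto (fun p : ℕ × ℕ => c.inner (y p.1 - y p.2) (y p.1 - y p.2)) atTop (𝓝 0))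
    (hx' : Tendsto (fun p : ℕ × ℕ => c.inner (x' p.1 - x' p.2) (x' p.1 - x' p.2)) atTop (𝓝 0))
    (hy' : Tendsto (fun p : ℕ × ℕ => c.inner (y' p.1 - y' p.2) (y' p.1 - y' p.2)) atTop (𝓝 0))
    (hxx : ∀ w, Tendsto (fun k => c.inner w (x k - x' k)) atTop (𝓝 0))
    (hyy : ∀ w, Tendsto (fun k => c.inner w (y k - y' k)) atTop (𝓝 0)) :
    ∃ z, Tendsto (fun k => c.inner (y k) (x k)) atTop (𝓝 z) ∧
      Tendsto (fun k => c.inner (y' k) (x' k)) atTop (𝓝 z) := by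
  let _ : NormedAddCommGroup V := c.toNormedAddCommGroup
  let _ : InnerProductSpace ℂ V := InnerProductSpace.ofCore c.toCore
  have key : ∀ s : ℕ → V,
      Tendsto (fun p : ℕ × ℕ => c.inner (s p.1 - s p.2) (s p.1 - s p.2)) atTop (𝓝 0) →
      ∃ S : UniformSpace.Completion V,
        Tendsto (fun k => (s k : UniformSpace.Completion V)) atTop (𝓝 S) := by
    intro s hs
    have h1 : CauchySeq s := by
      rw [cauchySeq_iff_tendsto_dist_atTop_0]
      have h2 := (hs.norm).sqrt
      simp only [norm_zero, Real.sqrt_zero] at h2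
      refine h2.congr fun p => ?_
      change √‖inner ℂ (s p.1 - s p.2) (s p.1 - s p.2)‖ = _
      rw [inner_self_eq_norm_sq_to_K, dist_eq_norm]
      simp
    exact cauchySeq_tendsto_of_complete
      ((UniformSpace.Completion.uniformContinuous_coe V).comp_cauchySeq h1)
  have uniq : ∀ (s s' : ℕ → V) (S S' : UniformSpace.Completion V),
      Tendsto (fun k => (s k : UniformSpace.Completion V)) atTop (𝓝 S) →
      Tendsto (fun k => (s' k : UniformSpace.Completion V)) atTop (𝓝 S') →
      (∀ w, Tendsto (fun k => c.inner w (s k - s' k)) atTop (𝓝 0)) → S = S' := by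
    intro s s' S S' hS hS' h
    rw [← sub_eq_zero]
    have h0 : ∀ W : UniformSpace.Completion V, inner ℂ W (S - S') = 0 := by
      intro W
      induction W using UniformSpace.Completion.induction_on with
      | hp => exact isClosed_eq (by fun_prop) continuous_const
      | ih w =>
        refine tendsto_nhds_unique ((tendsto_const_nhds (x := (w : UniformSpace.Completion V))).inner
          (hS.sub hS')) ?_
        refine (h w).congr fun k => ?_
        rw [← UniformSpace.Completion.coe_sub, UniformSpace.Completion.inner_coe]
    exact inner_self_eq_zero.mp (h0 _)
  obtain ⟨X, hX⟩ := key x hx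
  obtain ⟨Y, hY⟩ := key y hy
  obtain ⟨X', hX'⟩ := key x' hx'
  obtain ⟨Y', hY'⟩ := key y' hy'
  have e1 := uniq _ _ _ _ hX hX' hxx
  have e2 := uniq _ _ _ _ hY hY' hyy
  subst e1 e2
  refine ⟨inner ℂ Y X, ?_, ?_⟩
  · refine (hY.inner hX).congr fun k => ?_
    rw [UniformSpace.Completion.inner_coe]
  · refine (hY'.inner hX').congr fun k => ?_
    rw [UniformSpace.Completion.inner_coe]

/-- For a semi-bounded self-adjoint operator, `𝔞[u, v]` is the limit of `⟨A (x k), y k⟩` for all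
sequences `x`, `y` that are form-convergent to `u`, `v`. -/
theorem tendsto_form [CompleteSpace H] {A : H →ₗ.[ℂ] H} (hA : IsSelfAdjoint A)
    (hb : IsSemibounded A) {x y : ℕ → A.domain} {u v : H} (hx : FormApprox A x u)
    (hy : FormApprox A y v) :
    Tendsto (fun k => inner ℂ (y k : H) (A (x k))) atTop (𝓝 (form A u v)) := by
  obtain ⟨c, hc⟩ := hb
  have hsym : ∀ x y : A.domain, inner ℂ (A x) (y : H) = inner ℂ (x : H) (A y) := by
    have h := LinearPMap.adjoint_isFormalAdjoint (T := A) hA.dense_domain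
    rw [LinearPMap.isSelfAdjoint_def.mp hA] at h
    exact h
  let B : InnerProductSpace.Core ℂ A.domain :=
    { inner := fun y x => inner ℂ (y : H) (A x) + (1 - c : ℝ) * inner ℂ (y : H) (x : H)
      conj_inner_symm := fun y x => by
        simp only [map_add, map_mul, inner_conj_symm, hsym, Complex.conj_ofReal]
      re_inner_nonneg := fun x => by
        have h1 := hc x
        have h2 : (inner ℂ (x : H) (x : H)).re = ‖(x : H)‖ ^ 2 := inner_self_eq_norm_sq (𝕜 := ℂ) _
        simp only [RCLike.re_to_complex, Complex.add_re, Complex.re_ofReal_mul, h2]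
        nlinarith [sq_nonneg ‖(x : H)‖]
      add_left := fun x y z => by
        simp only [Submodule.coe_add, inner_add_left]; ring
      smul_left := fun x y r => by
        simp only [Submodule.coe_smul, inner_smul_left]; ring
      definite := fun x h => by
        have h1 := hc x
        have h2 : (inner ℂ (x : H) (x : H)).re = ‖(x : H)‖ ^ 2 := inner_self_eq_norm_sq (𝕜 := ℂ) _
        have h3 := congrArg Complex.re h
        simp only [Complex.add_re, Complex.re_ofReal_mul, h2, Complex.zero_re] at h3
        have h4 : ‖(x : H)‖ ^ 2 = 0 := le_antisymm (by linarith) (sq_nonneg _)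
        exact Subtype.ext (by simpa using h4) }
  have hBdef : ∀ y x : A.domain,
      B.inner y x = inner ℂ (y : H) (A x) + (1 - c : ℝ) * inner ℂ (y : H) (x : H) :=
    fun _ _ => rfl
  have hB : ∀ (s : ℕ → A.domain) (w : H), FormApprox A s w →
      Tendsto (fun p : ℕ × ℕ => B.inner (s p.1 - s p.2) (s p.1 - s p.2)) atTop (𝓝 0) := by
    intro s w hs
    have hd : Tendsto (fun p : ℕ × ℕ => ((s p.1 - s p.2 : A.domain) : H)) atTop (𝓝 0) := by
      rw [← prod_atTop_atTop_eq]
      have := (hs.1.comp tendsto_fst).sub (hs.1.comp (tendsto_snd (f := atTop (α := ℕ))))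
      simpa using this
    have h := hs.2.add ((hd.inner hd).const_mul ((1 - c : ℝ) : ℂ))
    simp only [inner_zero_left, mul_zero, add_zero] at h
    exact h
  have hw : ∀ (s s' : ℕ → A.domain) (w : H), FormApprox A s w → FormApprox A s' w →
      ∀ t, Tendsto (fun k => B.inner t (s k - s' k)) atTop (𝓝 0) := by
    intro s s' w hs hs' t
    have hd : Tendsto (fun k => ((s k - s' k : A.domain) : H)) atTop (𝓝 0) := by
      simpa using hs.1.sub hs'.1
    have h := ((tendsto_const_nhds (x := A t)).inner hd).add
      (((tendsto_const_nhds (x := (t : H))).inner hd).const_mul ((1 - c : ℝ) : ℂ))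
    simp only [inner_zero_right, mul_zero, add_zero] at h
    refine h.congr fun k => ?_
    rw [hBdef, ← hsym]
  have hu : u ∈ formDomain A := ⟨x, hx⟩
  have hv : v ∈ formDomain A := ⟨y, hy⟩
  have hx' := hu.choose_spec
  have hy' := hv.choose_spec
  obtain ⟨z, hz, hz'⟩ := core_limit B x y hu.choose hv.choose (hB _ _ hx) (hB _ _ hy) (hB _ _ hx')
    (hB _ _ hy') (hw _ _ _ hx hx') (hw _ _ _ hy hy')
  have l1 := hz.sub ((hy.1.inner hx.1).const_mul ((1 - c : ℝ) : ℂ))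
  have l2 := hz'.sub ((hy'.1.inner hx'.1).const_mul ((1 - c : ℝ) : ℂ))
  simp only [hBdef, add_sub_cancel_right] at l1 l2
  have hf : form A u v = limUnder atTop fun k => inner ℂ (hv.choose k : H) (A (hu.choose k)) := by
    rw [form, dif_pos ⟨hu, hv⟩]
  rw [hf, l2.limUnder_eq]
  exact l1

end

end Galerkin

/-!
The filtered space `𝓜_n` is all of `𝓛_n(Δ)` for large `n`, and `𝓛_n(Δ)` always has the Galerkin
eigenvalues `σ(A, 𝓛_n) ∩ Δ`.

Let `E`, `P`, `Q_n` be the orthogonal projections onto `𝓛(Δ)`, `L`, `𝓛_n(Δ)`. Since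
`δ(𝓛(Δ), L) < 1`, the projection `P` is injective on `𝓛(Δ)`. Hence `𝓛(Δ)` is finite-dimensional
(`finiteDimensional_of_gap_lt_one`), and if it is not zero, then the minimum of `‖P u‖² / ‖u‖²` on
it, which is an eigenvalue of the compression `E P|_𝓛(Δ)`, is positive. As a non-zero eigenvalue of
the finite rank operator `E P E` it is in the discrete spectrum
(`mem_discreteSpectrum_of_hasEigenvalue`). This gives `γ ‖u‖² ≤ ‖P u‖²` on `𝓛(Δ)`
(`gamma_mul_norm_sq_le`). As `δ(𝓛_n(Δ), 𝓛(Δ)) → 0`, the bound `(γ / 2) ‖u‖² ≤ ‖P u‖²` holds on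
`𝓛_n(Δ)` for all large `n` (`le_norm_starProjection_of_gap_le`). The eigenvalues of the symmetric
operator `Q_n P|_𝓛_n(Δ)` are values of `‖P u‖² / ‖u‖²`, so all of them are in `[γ / 2, 1]`, and `𝓜_n
= 𝓛_n(Δ)` (`eventually_filteredSpace_eq`). If `γ = 0`, this holds for every `n`.

The second fact is linear algebra (`galerkinSpectrum_galerkinSpaceIn`): the form, being
sesquilinear, is represented on the finite-dimensional space `𝓛_n` by an endomorphism `T`, and
`𝓛_n(Δ)` is the sum of the eigenspaces of `T` for `Δ`.
-/

namespace Galerkin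

variable {H : Type*} [NormedAddCommGroup H] [InnerProductSpace ℂ H]

/-! ### Sesquilinearity of the form -/

theorem inner_apply_symm [CompleteSpace H] {A : H →ₗ.[ℂ] H} (hA : IsSelfAdjoint A)
    (x y : A.domain) : inner ℂ (A x) (y : H) = inner ℂ (x : H) (A y) := by
  have h := LinearPMap.adjoint_isFormalAdjoint (T := A) hA.dense_domain
  rw [LinearPMap.isSelfAdjoint_def.mp hA] at h
  exact h x y

theorem FormApprox.tendsto_sub {A : H →ₗ.[ℂ] H} {x : ℕ → A.domain} {u : H}
    (hx : FormApprox A x u) :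
    Tendsto (fun p : ℕ × ℕ => ((x p.1 - x p.2 : A.domain) : H)) atTop (𝓝 0) := by
  rw [← prod_atTop_atTop_eq]
  simpa using (hx.1.comp tendsto_fst).sub (hx.1.comp (tendsto_snd (f := atTop (α := ℕ))))

theorem FormApprox.smul {A : H →ₗ.[ℂ] H} {x : ℕ → A.domain} {u : H} (hx : FormApprox A x u)
    (c : ℂ) : FormApprox A (fun k => c • x k) (c • u) := by
  refine ⟨by simpa using hx.1.const_smul c, ?_⟩
  have h := hx.2.const_mul (starRingEnd ℂ c * c)
  rw [mul_zero] at h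
  refine h.congr fun p => ?_
  rw [← smul_sub, A.map_smul, Submodule.coe_smul, inner_smul_left, inner_smul_right, mul_assoc]

/-- Form-convergent sequences may be added: for the non-negative form
`r d = ⟨A d, d⟩ - c ‖d‖²` the parallelogram identity gives `r (d + e) ≤ 2 r d + 2 r e`. -/
theorem FormApprox.add [CompleteSpace H] {A : H →ₗ.[ℂ] H} (hA : IsSelfAdjoint A)
    (hb : IsSemibounded A) {x y : ℕ → A.domain} {u v : H} (hx : FormApprox A x u)
    (hy : FormApprox A y v) : FormApprox A (fun k => x k + y k) (u + v) := by
  obtain ⟨c, hc⟩ := hb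
  refine ⟨by simpa using hx.1.add hy.1, ?_⟩
  let r : A.domain → ℝ := fun d => (inner ℂ (d : H) (A d)).re - c * ‖(d : H)‖ ^ 2
  have hr0 : ∀ d, 0 ≤ r d := fun d => sub_nonneg.mpr (hc d)
  have hpar : ∀ d e, r (d + e) ≤ 2 * r d + 2 * r e := by
    intro d e
    have h1 := parallelogram_law_with_norm ℂ (d : H) (e : H)
    have h2 := hr0 (d - e)
    simp only [r, Submodule.coe_add, Submodule.coe_sub, A.map_add, A.map_sub, inner_add_left,
      inner_add_right, inner_sub_left, inner_sub_right, Complex.add_re, Complex.sub_re] at h2 ⊢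
    linear_combination h2 - c * h1
  have hr : ∀ {s : ℕ → A.domain} {w : H}, FormApprox A s w →
      Tendsto (fun p : ℕ × ℕ => r (s p.1 - s p.2)) atTop (𝓝 0) := by
    intro s w hs
    have h1 := (Complex.continuous_re.tendsto _).comp hs.2
    have h2 := (hs.tendsto_sub.norm.pow 2).const_mul c
    have h := h1.sub h2
    simp only [Complex.zero_re, norm_zero, ne_eq, OfNat.ofNat_ne_zero, not_false_eq_true, zero_pow,
      mul_zero, sub_zero] at h
    exact h
  have hr' : Tendsto (fun p : ℕ × ℕ => r ((x p.1 - x p.2) + (y p.1 - y p.2))) atTop (𝓝 0) := by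
    refine squeeze_zero (fun p => hr0 _) (fun p => hpar _ _) ?_
    simpa using ((hr hx).const_mul 2).add ((hr hy).const_mul 2)
  have hn := ((hx.tendsto_sub.add hy.tendsto_sub).norm.pow 2).const_mul c
  have h := (Complex.continuous_ofReal.tendsto _).comp (hr'.add hn)
  simp only [add_zero, norm_zero, ne_eq, OfNat.ofNat_ne_zero, not_false_eq_true, zero_pow,
    mul_zero, Complex.ofReal_zero] at h
  refine h.congr fun p => ?_
  rw [add_sub_add_comm]
  simp only [Function.comp_apply, r, Submodule.coe_add, sub_add_cancel]
  -- the values of the quadratic form are real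
  refine Complex.conj_eq_iff_re.mp ?_
  rw [inner_conj_symm]
  exact inner_apply_symm hA (x p.1 - x p.2 + (y p.1 - y p.2)) (x p.1 - x p.2 + (y p.1 - y p.2))

theorem form_add_left [CompleteSpace H] {A : H →ₗ.[ℂ] H} (hA : IsSelfAdjoint A)
    (hb : IsSemibounded A) {u u' v : H} (hu : u ∈ formDomain A) (hu' : u' ∈ formDomain A)
    (hv : v ∈ formDomain A) : form A (u + u') v = form A u v + form A u' v := by
  obtain ⟨x, hx⟩ := hu
  obtain ⟨x', hx'⟩ := hu'
  obtain ⟨y, hy⟩ := hv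
  refine tendsto_nhds_unique (tendsto_form hA hb (hx.add hA hb hx') hy) ?_
  refine ((tendsto_form hA hb hx hy).add (tendsto_form hA hb hx' hy)).congr fun k => ?_
  rw [A.map_add, inner_add_right]

theorem form_smul_left [CompleteSpace H] {A : H →ₗ.[ℂ] H} (hA : IsSelfAdjoint A)
    (hb : IsSemibounded A) (c : ℂ) {u v : H} (hu : u ∈ formDomain A)
    (hv : v ∈ formDomain A) : form A (c • u) v = c * form A u v := by
  obtain ⟨x, hx⟩ := hu
  obtain ⟨y, hy⟩ := hv
  refine tendsto_nhds_unique (tendsto_form hA hb (hx.smul c) hy) ?_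
  refine ((tendsto_form hA hb hx hy).const_mul c).congr fun k => ?_
  rw [A.map_smul, inner_smul_right]

theorem form_add_right [CompleteSpace H] {A : H →ₗ.[ℂ] H} (hA : IsSelfAdjoint A)
    (hb : IsSemibounded A) {u v v' : H} (hu : u ∈ formDomain A) (hv : v ∈ formDomain A)
    (hv' : v' ∈ formDomain A) : form A u (v + v') = form A u v + form A u v' := by
  obtain ⟨x, hx⟩ := hu
  obtain ⟨y, hy⟩ := hv
  obtain ⟨y', hy'⟩ := hv'
  refine tendsto_nhds_unique (tendsto_form hA hb hx (hy.add hA hb hy')) ?_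
  refine ((tendsto_form hA hb hx hy).add (tendsto_form hA hb hx hy')).congr fun k => ?_
  rw [Submodule.coe_add, inner_add_left]

theorem form_smul_right [CompleteSpace H] {A : H →ₗ.[ℂ] H} (hA : IsSelfAdjoint A)
    (hb : IsSemibounded A) (c : ℂ) {u v : H} (hu : u ∈ formDomain A)
    (hv : v ∈ formDomain A) : form A u (c • v) = starRingEnd ℂ c * form A u v := by
  obtain ⟨x, hx⟩ := hu
  obtain ⟨y, hy⟩ := hv
  refine tendsto_nhds_unique (tendsto_form hA hb hx (hy.smul c)) ?_
  refine ((tendsto_form hA hb hx hy).const_mul (starRingEnd ℂ c)).congr fun k => ?_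
  rw [Submodule.coe_smul, inner_smul_left]

/-! ### Galerkin eigenvalues of a spectral subspace of a trial space -/

/-- On a finite-dimensional trial space the form is represented by an endomorphism. -/
theorem exists_end_form_eq_inner [CompleteSpace H] {A : H →ₗ.[ℂ] H} (hA : IsSelfAdjoint A)
    (hb : IsSemibounded A) {K : Submodule ℂ H} [FiniteDimensional ℂ K]
    (hK : (K : Set H) ⊆ formDomain A) :
    ∃ T : Module.End ℂ K, ∀ u v : K, form A u v = inner ℂ (v : H) (T u : H) := by
  have hcomplete : CompleteSpace K := FiniteDimensional.complete ℂ K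
  let f : K → K →ₗ[ℂ] ℂ := fun u =>
    { toFun := fun v => starRingEnd ℂ (form A u v)
      map_add' := fun v w => by
        rw [Submodule.coe_add, form_add_right hA hb (hK u.2) (hK v.2) (hK w.2), map_add]
      map_smul' := fun c v => by
        rw [Submodule.coe_smul, form_smul_right hA hb c (hK u.2) (hK v.2), map_mul,
          Complex.conj_conj, RingHom.id_apply, smul_eq_mul] }
  let g : K → K := fun u => (InnerProductSpace.toDual ℂ K).symm (f u).toContinuousLinearMap
  have hg : ∀ u v : K, inner ℂ v (g u) = form A u v := by
    intro u v
    rw [← inner_conj_symm, InnerProductSpace.toDual_symm_apply]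
    exact Complex.conj_conj _
  refine ⟨⟨⟨g, fun u w => ?_⟩, fun c u => ?_⟩, fun u v => (hg u v).symm⟩
  · refine ext_inner_left ℂ fun v => ?_
    rw [inner_add_right, hg, hg, hg, Submodule.coe_add,
      form_add_left hA hb (hK u.2) (hK w.2) (hK v.2)]
  · refine ext_inner_left ℂ fun v => ?_
    rw [RingHom.id_apply, inner_smul_right, hg, hg, Submodule.coe_smul,
      form_smul_left hA hb c (hK u.2) (hK v.2)]

theorem galerkinSpaceIn_le (A : H →ₗ.[ℂ] H) (K : Submodule ℂ H) (a b : ℝ) :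
    galerkinSpaceIn A K a b ≤ K :=
  Submodule.span_le.mpr fun _ hu => hu.1

/-- Let the endomorphism `T` represent the form on the trial space `K`. Then `K(Δ)` is the sum of
the eigenspaces of `T` for `Δ`. It is invariant under `T`, so its Galerkin eigenvectors are
eigenvectors of `T`, and the eigenvalue is in `Δ` because eigenspaces for distinct eigenvalues are
independent. -/
theorem galerkinSpectrum_galerkinSpaceIn [CompleteSpace H] {A : H →ₗ.[ℂ] H}
    (hA : IsSelfAdjoint A) (hb : IsSemibounded A) {K : Submodule ℂ H} [FiniteDimensional ℂ K]
    (hK : (K : Set H) ⊆ formDomain A) (a b : ℝ) :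
    galerkinSpectrum A (galerkinSpaceIn A K a b) = galerkinSpectrum A K ∩ Set.Icc a b := by
  obtain ⟨T, hT⟩ := exists_end_form_eq_inner hA hb hK
  have hle := galerkinSpaceIn_le A K a b
  have heig : ∀ (u : K) (μ : ℝ),
      (∀ v ∈ K, form A u v = (μ : ℂ) * inner ℂ v (u : H)) ↔ T u = (μ : ℂ) • u := by
    intro u μ
    constructor
    · intro h
      refine ext_inner_left ℂ fun v => ?_
      rw [inner_smul_right]
      exact (hT u v).symm.trans (h v v.2)
    · intro h v hv
      rw [hT u ⟨v, hv⟩, h, Submodule.coe_smul, inner_smul_right]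
  have hspan : ∀ u : K, (u : H) ∈ galerkinSpaceIn A K a b →
      u ∈ ⨆ μ ∈ Set.Icc a b, T.eigenspace (μ : ℂ) := by
    have : galerkinSpaceIn A K a b ≤
        (⨆ μ ∈ Set.Icc a b, T.eigenspace (μ : ℂ)).map K.subtype := by
      refine Submodule.span_le.mpr ?_
      rintro u ⟨huK, μ, hμ, hu⟩
      refine ⟨⟨u, huK⟩, ?_, rfl⟩
      exact Submodule.mem_iSup_of_mem μ (Submodule.mem_iSup_of_mem hμ
        (Module.End.mem_eigenspace_iff.mpr ((heig ⟨u, huK⟩ μ).mp hu)))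
    intro u hu
    obtain ⟨w, hw, hwu⟩ := this hu
    rwa [← Subtype.ext hwu]
  have hinv : ∀ u : K, (u : H) ∈ galerkinSpaceIn A K a b →
      (T u : H) ∈ galerkinSpaceIn A K a b := by
    have : galerkinSpaceIn A K a b ≤ ((galerkinSpaceIn A K a b).comap
        (K.subtype ∘ₗ T)).map K.subtype := by
      refine Submodule.span_le.mpr ?_
      rintro u ⟨huK, μ, hμ, hu⟩
      have h1 : (T ⟨u, huK⟩ : H) ∈ galerkinSpaceIn A K a b := by
        rw [(heig ⟨u, huK⟩ μ).mp hu, Submodule.coe_smul]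
        exact Submodule.smul_mem _ _ (Submodule.subset_span ⟨huK, μ, hμ, hu⟩)
      exact ⟨⟨u, huK⟩, h1, rfl⟩
    intro u hu
    obtain ⟨w, hw, hwu⟩ := this hu
    rwa [← Subtype.ext hwu]
  ext μ
  constructor
  · rintro ⟨u, hu, hu0, h⟩
    let u' : K := ⟨u, hle hu⟩
    have hTu : T u' = (μ : ℂ) • u' := by
      -- by invariance the residual is an admissible test vector, so it is orthogonal to itself
      have hw : ((T u' - (μ : ℂ) • u' : K) : H) ∈ galerkinSpaceIn A K a b :=
        Submodule.sub_mem _ (hinv u' hu) (Submodule.smul_mem _ _ hu)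
      have h1 := h _ hw
      rw [hT u' (T u' - (μ : ℂ) • u'), ← inner_smul_right, ← sub_eq_zero, ← inner_sub_right] at h1
      exact sub_eq_zero.mp (Subtype.ext (inner_self_eq_zero.mp h1))
    refine ⟨⟨u, hle hu, hu0, (heig u' μ).mpr hTu⟩, ?_⟩
    by_contra hμ
    have h2 : u' ∈ ⨆ ν ≠ (μ : ℂ), T.eigenspace ν := by
      refine (iSup₂_le fun ν hν => ?_ :
        (⨆ μ ∈ Set.Icc a b, T.eigenspace (μ : ℂ)) ≤ _) (hspan u' hu)
      refine le_iSup₂_of_le (ν : ℂ) (fun h => hμ ?_) le_rfl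
      rwa [← Complex.ofReal_injective h]
    have h3 := Submodule.disjoint_def.mp (T.eigenspaces_iSupIndep (μ : ℂ)) u'
      (Module.End.mem_eigenspace_iff.mpr hTu) h2
    exact hu0 (congrArg Subtype.val h3)
  · rintro ⟨⟨u, hu, hu0, h⟩, hμ⟩
    exact ⟨u, Submodule.subset_span ⟨hu, μ, hμ, h⟩, hu0, fun v hv => h v (hle hv)⟩

/-! ### Orthogonal projections and the gap -/

theorem proj_eq_starProjection [CompleteSpace H] (K : Submodule ℂ H) [FiniteDimensional ℂ K] :
    proj K = K.starProjection := by
  have h : K.topologicalClosure = K := K.closed_of_finiteDimensional.submodule_topologicalClosure_eq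
  unfold proj
  congr!

theorem norm_sub_starProjection_le_gap_mul (K M : Submodule ℂ H) [FiniteDimensional ℂ M] {u : H}
    (hu : u ∈ K) : ‖u - M.starProjection u‖ ≤ gap K M * ‖u‖ := by
  have hdist : ∀ w : H, Metric.infDist w (M : Set H) = ‖w - M.starProjection w‖ := by
    intro w
    rw [Metric.infDist_eq_iInf, Submodule.starProjection_minimal]
    simp only [dist_eq_norm]
    rfl
  rcases eq_or_ne u 0 with rfl | hu0
  · simp
  have hn : ‖u‖ ≠ 0 := norm_ne_zero_iff.mpr hu0
  let w : H := ((‖u‖⁻¹ : ℝ) : ℂ) • u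
  have hw : ‖w - M.starProjection w‖ ≤ gap K M := by
    refine le_csSup ⟨1, ?_⟩ ⟨w, K.smul_mem _ hu, ?_, (hdist w).symm⟩
    · rintro _ ⟨v, -, hv, rfl⟩
      have := Metric.infDist_le_dist_of_mem (x := v) M.zero_mem
      rwa [dist_zero_right, hv] at this
    · rw [norm_smul, Complex.norm_real, norm_inv, norm_norm, inv_mul_cancel₀ hn]
  have hw' : ‖w - M.starProjection w‖ = ‖u‖⁻¹ * ‖u - M.starProjection u‖ := by
    rw [map_smul, ← smul_sub, norm_smul, Complex.norm_real, norm_inv, norm_norm]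
  rw [hw', inv_mul_le_iff₀ (norm_pos_iff.mpr hu0)] at hw
  linarith

theorem eq_zero_of_starProjection_eq_zero {K L : Submodule ℂ H} [FiniteDimensional ℂ L]
    (hgap : gap K L < 1) {u : H} (hu : u ∈ K) (h : L.starProjection u = 0) : u = 0 := by
  have h1 := norm_sub_starProjection_le_gap_mul K L hu
  rw [h, sub_zero] at h1
  have h2 := norm_nonneg u
  exact norm_eq_zero.mp (by nlinarith)

theorem finiteDimensional_of_gap_lt_one {K L : Submodule ℂ H} [FiniteDimensional ℂ L]
    (hgap : gap K L < 1) : FiniteDimensional ℂ K := by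
  let f : K →ₗ[ℂ] L := (L.orthogonalProjectionOnto : H →ₗ[ℂ] L) ∘ₗ K.subtype
  refine FiniteDimensional.of_injective f ((injective_iff_map_eq_zero f).mpr fun u hu => ?_)
  refine Subtype.ext (eq_zero_of_starProjection_eq_zero hgap u.2 ?_)
  rw [Submodule.starProjection_apply]
  exact congrArg Subtype.val hu

/-- A lower bound for a projection on `M` passes to subspaces that are close to `M`. -/
theorem le_norm_starProjection_of_gap_le {K M L : Submodule ℂ H} [FiniteDimensional ℂ M]
    [FiniteDimensional ℂ L] {s t : ℝ} (hs : 0 ≤ s)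
    (hM : ∀ u ∈ M, s * ‖u‖ ≤ ‖L.starProjection u‖) (hgap : gap K M * (s + 1) ≤ s - t)
    {u : H} (hu : u ∈ K) : t * ‖u‖ ≤ ‖L.starProjection u‖ := by
  set Eu := M.starProjection u
  have h1 : ‖u - Eu‖ ≤ gap K M * ‖u‖ := norm_sub_starProjection_le_gap_mul K M hu
  have h2 := hM Eu (M.starProjection_apply_mem u)
  have h3 : ‖L.starProjection Eu‖ ≤ ‖L.starProjection u‖ + ‖u - Eu‖ := by
    have h := norm_sub_le (L.starProjection u) (L.starProjection (u - Eu))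
    rw [← map_sub, sub_sub_cancel] at h
    linarith [L.norm_starProjection_apply_le (u - Eu)]
  have h4 : ‖u‖ ≤ ‖Eu‖ + ‖u - Eu‖ := by
    simpa using norm_add_le Eu (u - Eu)
  have h5 := mul_le_mul_of_nonneg_left h4 hs
  have h6 := mul_le_mul_of_nonneg_right h1 (by linarith : 0 ≤ s + 1)
  have h7 := mul_le_mul_of_nonneg_right hgap (norm_nonneg u)
  linarith

/-! ### Compressions of projections -/

/-- The compression `Q P|_K` of the orthogonal projection `P` onto `L` to `K`, where `Q` is the
orthogonal projection onto `K`. -/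
noncomputable def compression (K L : Submodule ℂ H) [FiniteDimensional ℂ K]
    [FiniteDimensional ℂ L] : Module.End ℂ K :=
  (K.orthogonalProjectionOnto : H →ₗ[ℂ] K) ∘ₗ (L.starProjection : H →ₗ[ℂ] H) ∘ₗ K.subtype

section Compression

variable (K L : Submodule ℂ H) [FiniteDimensional ℂ K] [FiniteDimensional ℂ L]

theorem coe_compression (u : K) :
    (compression K L u : H) = K.starProjection (L.starProjection (u : H)) :=
  rfl

theorem inner_starProjection_self (u : H) :
    inner ℂ (L.starProjection u) u = ((‖L.starProjection u‖ ^ 2 : ℝ) : ℂ) := by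
  have h : L.starProjection (L.starProjection u) = L.starProjection u :=
    Submodule.starProjection_eq_self_iff.mpr (L.starProjection_apply_mem u)
  conv_lhs => rw [← h]
  rw [L.inner_starProjection_left_eq_right, inner_self_eq_norm_sq_to_K]
  norm_cast

theorem inner_compression_left (u v : K) :
    inner ℂ (compression K L u) v = inner ℂ (L.starProjection (u : H)) (v : H) := by
  rw [Submodule.coe_inner, coe_compression, K.inner_starProjection_left_eq_right,
    Submodule.starProjection_eq_self_iff.mpr v.2]

theorem compression_isSymmetric : (compression K L).IsSymmetric := by
  intro u v
  rw [inner_compression_left, ← inner_conj_symm u, inner_compression_left, inner_conj_symm,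
    L.inner_starProjection_left_eq_right]

theorem inner_compression_self (u : K) :
    inner ℂ (compression K L u) u = ((‖L.starProjection (u : H)‖ ^ 2 : ℝ) : ℂ) := by
  rw [inner_compression_left, inner_starProjection_self]

/-- An eigenvalue of the compression is the quotient `‖P u‖² / ‖u‖²` at an eigenvector `u`. -/
theorem eq_of_compression_eq_smul {u : K} (hu : u ≠ 0) {z : ℂ} (h : compression K L u = z • u) :
    z = ((‖L.starProjection (u : H)‖ ^ 2 / ‖u‖ ^ 2 : ℝ) : ℂ) := by
  have h1 := inner_compression_self K L u
  have h0 : ‖u‖ ^ 2 ≠ 0 := pow_ne_zero _ (norm_ne_zero_iff.mpr hu)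
  rw [← inner_conj_symm, h, inner_smul_right, inner_self_eq_norm_sq_to_K] at h1
  have h2 : z * ((‖u‖ ^ 2 : ℝ) : ℂ) = ((‖L.starProjection (u : H)‖ ^ 2 : ℝ) : ℂ) := by
    have := congrArg (starRingEnd ℂ) h1
    rw [Complex.conj_conj, Complex.conj_ofReal] at this
    rw [← this]
    norm_cast
  rw [Complex.ofReal_div, eq_div_iff (by exact_mod_cast h0), h2]

/-- If `s ‖u‖² ≤ ‖P u‖²` on `K`, then all eigenvalues of `Q P|_K` are in `[s, 1]`, and its
eigenvectors span `K`. -/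
theorem compressionSpace_eq_self [CompleteSpace H] {s : ℝ}
    (hs : ∀ u ∈ K, s * ‖u‖ ^ 2 ≤ ‖L.starProjection u‖ ^ 2) : compressionSpace K L s = K := by
  refine le_antisymm (Submodule.span_le.mpr fun u hu => hu.1) ?_
  have htop : (⨆ μ, (compression K L).eigenspace μ) = ⊤ :=
    (Submodule.orthogonal_eq_bot_iff (K := ⨆ μ, (compression K L).eigenspace μ)).mp
      (compression_isSymmetric K L).orthogonalComplement_iSup_eigenspaces_eq_bot
  have hle : (⨆ μ, (compression K L).eigenspace μ) ≤
      (compressionSpace K L s).comap K.subtype := by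
    refine iSup_le fun z u hu => ?_
    rw [Module.End.mem_eigenspace_iff] at hu
    rcases eq_or_ne u 0 with rfl | hu0
    · exact Submodule.zero_mem _
    have hz := eq_of_compression_eq_smul K L hu0 hu
    have hpos : 0 < ‖u‖ ^ 2 := pow_pos (norm_pos_iff.mpr hu0) 2
    refine Submodule.subset_span ⟨u.2, ‖L.starProjection (u : H)‖ ^ 2 / ‖u‖ ^ 2, ⟨?_, ?_⟩, ?_⟩
    · exact (le_div_iff₀ hpos).mpr (hs u u.2)
    · exact (div_le_one hpos).mpr
        (pow_le_pow_left₀ (norm_nonneg _) (L.norm_starProjection_apply_le _) 2)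
    · rw [proj_eq_starProjection, proj_eq_starProjection, ← hz]
      exact congrArg Subtype.val hu
  intro u hu
  exact hle (htop ▸ Submodule.mem_top : (⟨u, hu⟩ : K) ∈ _)

/-! ### The discrete spectrum of `EPE` -/

/-- The finite rank operator `E P E`, where `E`, `P` are the orthogonal projections onto `K`,
`L`. -/
noncomputable def sandwich : H →L[ℂ] H :=
  K.starProjection ∘L L.starProjection ∘L K.starProjection

theorem isCompactOperator_sandwich : IsCompactOperator (sandwich K L) := by
  have h1 : IsCompactOperator (id : K → K) := isCompactOperator_id_iff_finiteDimensional.mpr ‹_›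
  exact (h1.clm_comp K.subtypeL).comp_clm
    (K.orthogonalProjectionOnto ∘L L.starProjection ∘L K.starProjection)

/-- Eigenvectors of `E P E` for non-zero eigenvalues are in `K`. -/
theorem mem_of_sandwich_eq_smul {u : H} {z : ℂ} (hz : z ≠ 0) (h : sandwich K L u = z • u) :
    ∃ hu : u ∈ K, compression K L ⟨u, hu⟩ = z • ⟨u, hu⟩ := by
  have hu : u ∈ K := by
    rw [← inv_smul_smul₀ hz u, ← h]
    exact K.smul_mem _ (K.starProjection_apply_mem _)
  refine ⟨hu, Subtype.ext ?_⟩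
  rw [coe_compression, Submodule.coe_smul, ← h]
  simp [sandwich, Submodule.starProjection_eq_self_iff.mpr hu]

theorem sandwich_coe (u : K) : sandwich K L u = compression K L u := by
  simp [sandwich, coe_compression]

theorem mem_eigenspace_toPMap {T : H →L[ℂ] H} {z : ℂ} {u : H} :
    u ∈ eigenspace ((T : H →ₗ[ℂ] H).toPMap ⊤) z ↔ T u = z • u :=
  ⟨fun h => h.2, fun h => ⟨Submodule.mem_top, h⟩⟩

theorem mem_resolventSet_toPMap {T : H →L[ℂ] H} {z : ℂ} (h : z ∈ _root_.resolventSet ℂ T) :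
    z ∈ resolventSet ((T : H →ₗ[ℂ] H).toPMap ⊤) := by
  obtain ⟨R, hR⟩ := h
  have hR' : ∀ x, (R : H →L[ℂ] H) x = z • x - T x := fun x => by
    rw [hR, sub_apply, Algebra.algebraMap_eq_smul_one]
    rfl
  refine ⟨-(R⁻¹ : (H →L[ℂ] H)ˣ), fun y => ⟨Submodule.mem_top, ?_⟩, fun x => ?_⟩
  · have h := congrArg (fun S : H →L[ℂ] H => S y) R.mul_inv
    change (R : H →L[ℂ] H) (((R⁻¹ : (H →L[ℂ] H)ˣ) : H →L[ℂ] H) y) = y at h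
    rw [hR'] at h
    change T (-(((R⁻¹ : (H →L[ℂ] H)ˣ) : H →L[ℂ] H) y)) -
      z • (-(((R⁻¹ : (H →L[ℂ] H)ˣ) : H →L[ℂ] H) y)) = y
    rw [map_neg, smul_neg, sub_neg_eq_add, neg_add_eq_sub, h]
  · have h := congrArg (fun S : H →L[ℂ] H => S x) R.inv_mul
    change ((R⁻¹ : (H →L[ℂ] H)ˣ) : H →L[ℂ] H) ((R : H →L[ℂ] H) x) = x at h
    rw [hR'] at h
    change -(((R⁻¹ : (H →L[ℂ] H)ˣ) : H →L[ℂ] H) (T x - z • (x : H))) = x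
    rw [← map_neg, neg_sub, h]

theorem mem_spectrum_toPMap {T : H →L[ℂ] H} {z : ℂ} {u : H} (hu : u ≠ 0) (h : T u = z • u) :
    z ∈ spectrum ((T : H →ₗ[ℂ] H).toPMap ⊤) := by
  rintro ⟨R, -, hR⟩
  have h1 : R (T u - z • u) = u := hR ⟨u, Submodule.mem_top⟩
  rw [h, sub_self, map_zero] at h1
  exact hu h1.symm

theorem hasEigenvalue_compression_of_mem_spectrum [CompleteSpace H] {z : ℂ} (hz : z ≠ 0)
    (h : z ∈ spectrum ((sandwich K L : H →ₗ[ℂ] H).toPMap ⊤)) :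
    (compression K L).HasEigenvalue z := by
  rcases (isCompactOperator_sandwich K L).hasEigenvalue_or_mem_resolventSet hz with h1 | h1
  · obtain ⟨u, hu⟩ := h1.exists_hasEigenvector
    obtain ⟨huK, h2⟩ := mem_of_sandwich_eq_smul K L hz hu.apply_eq_smul
    exact Module.End.hasEigenvalue_of_hasEigenvector (x := ⟨u, huK⟩)
      ⟨Module.End.mem_eigenspace_iff.mpr h2, fun h0 => hu.2 (congrArg Subtype.val h0)⟩
  · exact absurd (mem_resolventSet_toPMap h1) h

/-- Every non-zero eigenvalue of `E P|_K` is in the discrete spectrum of `E P E`: the non-zero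
spectrum of `E P E` consists of the finitely many eigenvalues of `E P|_K`. -/
theorem mem_discreteSpectrum_of_hasEigenvalue [CompleteSpace H] {z : ℂ} (hz : z ≠ 0)
    (h : (compression K L).HasEigenvalue z) :
    z ∈ discreteSpectrum ((sandwich K L : H →ₗ[ℂ] H).toPMap ⊤) := by
  obtain ⟨u, hu⟩ := h.exists_hasEigenvector
  have hu0 : (u : H) ≠ 0 := fun h0 => hu.2 (Subtype.ext h0)
  have hTu : sandwich K L u = z • (u : H) := by
    rw [sandwich_coe, hu.apply_eq_smul, Submodule.coe_smul]
  refine ⟨mem_spectrum_toPMap hu0 hTu, ?_, ?_, ?_⟩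
  · have hfin : (insert 0 {w | (compression K L).HasEigenvalue w} \ {z} : Set ℂ).Finite :=
      ((Module.End.finite_hasEigenvalue (f := compression K L)).insert 0).sdiff
    -- a ball around `z` that avoids `0` and the other eigenvalues of the compression
    obtain ⟨ε, hε, hball⟩ := Metric.isOpen_iff.mp hfin.isClosed.isOpen_compl z (by simp)
    refine ⟨ε, hε, fun w hw hwz => ?_⟩
    by_contra hne
    refine hball (Metric.mem_ball.mpr hwz) ⟨?_, hne⟩
    rcases eq_or_ne w 0 with rfl | hw0
    · exact Set.mem_insert _ _
    · exact Set.mem_insert_of_mem _ (hasEigenvalue_compression_of_mem_spectrum K L hw0 hw)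
  · exact fun hbot => hu0 ((Submodule.mem_bot ℂ).mp (hbot ▸ mem_eigenspace_toPMap.mpr hTu))
  · have hle : eigenspace ((sandwich K L : H →ₗ[ℂ] H).toPMap ⊤) z ≤ K := fun v hv =>
      (mem_of_sandwich_eq_smul K L hz (mem_eigenspace_toPMap.mp hv)).1
    exact Submodule.finiteDimensional_of_le hle

theorem nonneg_of_mem_discreteSpectrum {t : ℝ} (ht : t ≠ 0)
    (h : (t : ℂ) ∈ discreteSpectrum ((sandwich K L : H →ₗ[ℂ] H).toPMap ⊤)) : 0 ≤ t := by
  obtain ⟨u, hu, hu0⟩ := Submodule.exists_mem_ne_zero_of_ne_bot h.2.2.1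
  obtain ⟨huK, h1⟩ := mem_of_sandwich_eq_smul K L (Complex.ofReal_ne_zero.mpr ht)
    (mem_eigenspace_toPMap.mp hu)
  have h2 := eq_of_compression_eq_smul K L (fun h0 => hu0 (congrArg Subtype.val h0)) h1
  rw [Complex.ofReal_injective h2]
  positivity

end Compression

theorem gamma_eq [CompleteSpace H] (A : H →ₗ.[ℂ] H) (a b : ℝ) (L : Submodule ℂ H)
    [FiniteDimensional ℂ (eigenspaceIn A a b)] [FiniteDimensional ℂ L] :
    gamma A a b L = sInf {t : ℝ | t ≠ 0 ∧ (t : ℂ) ∈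
      discreteSpectrum ((sandwich (eigenspaceIn A a b) L : H →ₗ[ℂ] H).toPMap ⊤)} := by
  simp only [gamma, proj_eq_starProjection, sandwich]

theorem gamma_nonneg [CompleteSpace H] (A : H →ₗ.[ℂ] H) (a b : ℝ) (L : Submodule ℂ H)
    [FiniteDimensional ℂ (eigenspaceIn A a b)] [FiniteDimensional ℂ L] : 0 ≤ gamma A a b L := by
  rw [gamma_eq]
  exact Real.sInf_nonneg fun t ht => nonneg_of_mem_discreteSpectrum _ _ ht.1 ht.2

/-- `γ` is at most the minimum of `‖P u‖² / ‖u‖²` on `𝓛(Δ)`. That minimum is an eigenvalue of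
`E P|_𝓛(Δ)`, and it is not zero because `P` is injective on `𝓛(Δ)`. -/
theorem gamma_mul_norm_sq_le [CompleteSpace H] (A : H →ₗ.[ℂ] H) (a b : ℝ) (L : Submodule ℂ H)
    [FiniteDimensional ℂ (eigenspaceIn A a b)] [FiniteDimensional ℂ L]
    (hgap : gap (eigenspaceIn A a b) L < 1) {u : H} (hu : u ∈ eigenspaceIn A a b) :
    gamma A a b L * ‖u‖ ^ 2 ≤ ‖L.starProjection u‖ ^ 2 := by
  rcases eq_or_ne u 0 with rfl | hu0
  · simp
  rw [gamma_eq]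
  set K := eigenspaceIn A a b
  let u' : K := ⟨u, hu⟩
  have hu0' : u' ≠ 0 := fun h => hu0 (congrArg Subtype.val h)
  have : Nontrivial K := ⟨u', 0, hu0'⟩
  have heig := (compression_isSymmetric K L).hasEigenvalue_iInf_of_finiteDimensional
  set m : ℝ := ⨅ x : { x : K // x ≠ 0 },
    RCLike.re (inner ℂ (compression K L x) (x : K)) / ‖(x : K)‖ ^ 2
  have hm0 : m ≠ 0 := by
    intro hm
    obtain ⟨v, hv⟩ := heig.exists_hasEigenvector
    have hv' : compression K L v = 0 := by simpa [hm] using hv.apply_eq_smul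
    have h1 := inner_compression_self K L v
    rw [hv', inner_zero_left, eq_comm, Complex.ofReal_eq_zero, sq_eq_zero_iff,
      norm_eq_zero] at h1
    exact hv.2 (Subtype.ext (eq_zero_of_starProjection_eq_zero hgap v.2 h1))
  have hquot : ∀ x : K, RCLike.re (inner ℂ (compression K L x) x) =
      ‖L.starProjection (x : H)‖ ^ 2 := by
    intro x
    rw [inner_compression_self]
    exact Complex.ofReal_re _
  have hle : m ≤ ‖L.starProjection u‖ ^ 2 / ‖u‖ ^ 2 := by
    have h := ciInf_le (f := fun x : { x : K // x ≠ 0 } =>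
      RCLike.re (inner ℂ (compression K L x) (x : K)) / ‖(x : K)‖ ^ 2) ⟨0, ?_⟩ ⟨u', hu0'⟩
    · simp only [hquot] at h
      simp only [m, hquot]
      exact h
    · rintro _ ⟨x, rfl⟩
      simp only [hquot]
      positivity
  have hγ : sInf {t : ℝ | t ≠ 0 ∧ (t : ℂ) ∈
      discreteSpectrum ((sandwich K L : H →ₗ[ℂ] H).toPMap ⊤)} ≤ m :=
    csInf_le ⟨0, fun t ht => nonneg_of_mem_discreteSpectrum K L ht.1 ht.2⟩
      ⟨hm0, mem_discreteSpectrum_of_hasEigenvalue K L (Complex.ofReal_ne_zero.mpr hm0) heig⟩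
  exact (le_div_iff₀ (pow_pos (norm_pos_iff.mpr hu0) 2)).mp (hγ.trans hle)

/-- In the absence of spectral pollution, `𝓜_n = 𝓛_n(Δ)` for all large `n`. -/
theorem eventually_filteredSpace_eq [CompleteSpace H] (A : H →ₗ.[ℂ] H) (a b : ℝ)
    (Ln : ℕ → Submodule ℂ H) [∀ n, FiniteDimensional ℂ (Ln n)]
    (L : Submodule ℂ H) [FiniteDimensional ℂ L] (hgap : gap (eigenspaceIn A a b) L < 1)
    (hpoll : Tendsto (fun n => gap (galerkinSpaceIn A (Ln n) a b) (eigenspaceIn A a b)) atTop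
      (𝓝 0)) :
    ∀ᶠ n in atTop, filteredSpace A a b L (Ln n) = galerkinSpaceIn A (Ln n) a b := by
  have hE : FiniteDimensional ℂ (eigenspaceIn A a b) := finiteDimensional_of_gap_lt_one hgap
  have hK : ∀ n, FiniteDimensional ℂ (galerkinSpaceIn A (Ln n) a b) := fun n =>
    Submodule.finiteDimensional_of_le (galerkinSpaceIn_le A (Ln n) a b)
  rcases (gamma_nonneg A a b L).eq_or_lt with h0 | hpos
  · refine Eventually.of_forall fun n => compressionSpace_eq_self _ _ fun u _ => ?_
    rw [← h0, zero_div, zero_mul]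
    positivity
  set γ := gamma A a b L
  have hM : ∀ u ∈ eigenspaceIn A a b, √γ * ‖u‖ ≤ ‖L.starProjection u‖ := by
    intro u hu
    refine le_of_sq_le_sq ?_ (norm_nonneg _)
    rw [mul_pow, Real.sq_sqrt hpos.le]
    exact gamma_mul_norm_sq_le A a b L hgap hu
  have hlt : 0 < √γ - √(γ / 2) :=
    sub_pos.mpr (Real.sqrt_lt_sqrt (by positivity) (by linarith))
  have hlim := hpoll.mul_const (√γ + 1)
  rw [zero_mul] at hlim
  filter_upwards [hlim.eventually_lt_const hlt] with n hn
  refine compressionSpace_eq_self _ _ fun u hu => ?_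
  have h := le_norm_starProjection_of_gap_le (Real.sqrt_nonneg γ) hM hn.le hu
  have h2 := pow_le_pow_left₀ (by positivity) h 2
  rwa [mul_pow, Real.sq_sqrt (by positivity)] at h2

end Galerkin

theorem mainTheorem8 {H : Type*} [NormedAddCommGroup H] [InnerProductSpace ℂ H] [CompleteSpace H]
    (A : H →ₗ.[ℂ] H) (hA : IsSelfAdjoint A) (hsb : Galerkin.IsSemibounded A)
    (a b : ℝ) (hab : a < b)
    (ha : (a : ℂ) ∈ Galerkin.resolventSet A) (hb : (b : ℂ) ∈ Galerkin.resolventSet A)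
    (hess : ∀ t ∈ Set.Icc a b, (t : ℂ) ∉ Galerkin.essentialSpectrum A)
    (Ln : ℕ → Submodule ℂ H) (hfin : ∀ n, FiniteDimensional ℂ (Ln n))
    (hdom : ∀ n, (Ln n : Set H) ⊆ Galerkin.formDomain A)
    (happrox : ∀ u ∈ Galerkin.formDomain A, ∃ w : ℕ → H, (∀ n, w n ∈ Ln n) ∧
      Tendsto (fun n => Galerkin.formNorm A (u - w n)) atTop (𝓝 0))
    (L : Submodule ℂ H) (hL : FiniteDimensional ℂ L)
    (hgap : Galerkin.gap (Galerkin.eigenspaceIn A a b) L < 1)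
    (hpoll : Tendsto
      (fun n => Galerkin.gap (Galerkin.galerkinSpaceIn A (Ln n) a b)
        (Galerkin.eigenspaceIn A a b)) atTop (𝓝 0)) :
    ∀ᶠ n in atTop,
      Galerkin.galerkinSpectrum A (Galerkin.filteredSpace A a b L (Ln n)) =
        Galerkin.galerkinSpectrum A (Ln n) ∩ Set.Icc a b := by
  filter_upwards [Galerkin.eventually_filteredSpace_eq A a b Ln L hgap hpoll] with n hn
  rw [hn]
  exact Galerkin.galerkinSpectrum_galerkinSpaceIn hA hsb (hdom n) a b
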